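/- Throughout, let $n\ge 1$. A cut-and-project scheme $\Lambda=(\mathcal L\subset\mathbb R^{s},\mathbb R^{n})$ with $s>n$ consists of a lattice $\mathcal L\subset\mathbb R^s$ (the $\mathbb Z$-span of a basis of $\mathbb R^s$) together with the projections $\pi_\parallel:\mathbb R^s\to\mathbb R^n$ and $\pi_\perp:\mathbb R^s\to\mathbb R^{s-n}$ onto the first $n$ and the last $s-n$ coordinates. The scheme is called generic if it is non-degenerate ($\pi_\parallel$ is injective on $\mathcal L$), aperiodic ($\pi_\perp$ is injective on $\mathcal L$) and irreducible ($\pi_\perp(\mathcal L)$ is dense in $\mathbb R^{s-n}$). Let $L\in\mathbb R^{s\times s}$ be a non-singular matrix whose columns form a $\mathbb Z$-basis of $\mathcal L$. A matrix $A\in\mathbb R^{n\times n}$ is a self-similarity of a generic scheme $\Lambda$ if $A\pi_\parallel(\mathcal L)\subset\pi_\parallel(\mathcal L)$ and there are matrices $C\in\mathbb Z^{s\times s}$ and $B\in\mathbb R^{(s-n)\times(s-n)}$ such that $$\begin{pmatrix}A&O\\O&B\end{pmatrix}L=LC$$ (this does not depend on the choice of $L$). **Theorem.** Let $A\in\mathbb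 R^{n\times n}$ be diagonalizable over $\mathbb C$. Then there exist an integer $s>n$ and a generic cut-and-project scheme $\Lambda=(\mathcal L\subset\mathbb R^{s},\mathbb R^{n})$ with self-similarity $A$ if and only if every eigenvalue of $A$ in $\mathbb C$ is an algebraic integer. -/

import Mathlib

/-- A square matrix over a field is diagonalizable if it is similar to a diagonal matrix. -/
def MatrixDiagonalizable {K ι : Type*} [Field K] [Fintype ι] [DecidableEq ι]
    (M : Matrix ι ι K) : Prop :=
  ∃ (P : Matrix ι ι K) (d : ι → K), IsUnit P ∧ M * P = P * Matrix.diagonal d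

/-- The space `ℝ^s` with `s = n + m`: the coordinates indexed by `Fin n` are the first `n` ones,
those indexed by `Fin m` the last `m = s - n` ones. -/
abbrev AmbientSpace (n m : ℕ) : Type := Fin n ⊕ Fin m → ℝ

/-- The square matrix `L` is associated to `𝓛`: it is non-singular and `𝓛` is the set of integer
combinations of its columns. -/
def IsAssociatedMatrix {n m : ℕ} (L : Matrix (Fin n ⊕ Fin m) (Fin n ⊕ Fin m) ℝ)
    (𝓛 : Submodule ℤ (AmbientSpace n m)) : Prop :=
  IsUnit L ∧ 𝓛 = Submodule.span ℤ (Set.range fun j => L.col j)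

/-- A cut-and-project scheme `(𝓛 ⊂ ℝ^s, ℝ^n)`, with `s = n + m`: a full-rank lattice `𝓛` in `ℝ^s`,
where the physical space `ℝ^n` and the internal space `ℝ^m` both have positive dimension. -/
structure CutAndProjectScheme (n m : ℕ) where
  physical_pos : 1 ≤ n
  internal_pos : 1 ≤ m
  lattice : Submodule ℤ (AmbientSpace n m)
  exists_associated : ∃ L, IsAssociatedMatrix L lattice

namespace CutAndProjectScheme

/-- Projection of `ℝ^s` to the physical space `ℝ^n` (first `n` coordinates). -/
def projPar (n m : ℕ) (x : AmbientSpace n m) : Fin n → ℝ := fun i => x (Sum.inl i)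

/-- Projection of `ℝ^s` to the internal space `ℝ^(s-n)` (last `s - n` coordinates). -/
def projPerp (n m : ℕ) (x : AmbientSpace n m) : Fin m → ℝ := fun i => x (Sum.inr i)

variable {n m : ℕ}

/-- The projection to the physical space is injective on the lattice. -/
def NonDegenerate (Λ : CutAndProjectScheme n m) : Prop :=
  Set.InjOn (projPar n m) (Λ.lattice : Set (AmbientSpace n m))

/-- The projection to the internal space is injective on the lattice. -/
def Aperiodic (Λ : CutAndProjectScheme n m) : Prop :=
  Set.InjOn (projPerp n m) (Λ.lattice : Set (AmbientSpace n m))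

/-- The projection of the lattice is dense in the internal space. -/
def Irreducible (Λ : CutAndProjectScheme n m) : Prop :=
  Dense (projPerp n m '' (Λ.lattice : Set (AmbientSpace n m)))

/-- Generic: non-degenerate, aperiodic and irreducible. -/
def Generic (Λ : CutAndProjectScheme n m) : Prop :=
  Λ.NonDegenerate ∧ Λ.Aperiodic ∧ Λ.Irreducible

/-- The linear map `A` of the physical space is a self-similarity of the scheme: the projected
lattice is closed under `A`, and for a matrix `L` associated to the lattice there are an integer
matrix `C` and a real matrix `B` with `diag(A, B) L = L C`. (The existence of `C` and `B` does not
depend on the choice of `L`.) -/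
def IsSelfSimilarity (Λ : CutAndProjectScheme n m) (A : Matrix (Fin n) (Fin n) ℝ) : Prop :=
  (∀ x ∈ projPar n m '' (Λ.lattice : Set (AmbientSpace n m)),
    A.mulVec x ∈ projPar n m '' (Λ.lattice : Set (AmbientSpace n m))) ∧
  ∃ L : Matrix (Fin n ⊕ Fin m) (Fin n ⊕ Fin m) ℝ, IsAssociatedMatrix L Λ.lattice ∧
    ∃ (C : Matrix (Fin n ⊕ Fin m) (Fin n ⊕ Fin m) ℤ) (B : Matrix (Fin m) (Fin m) ℝ),
      Matrix.fromBlocks A 0 0 B * L = L * C.map (Int.cast : ℤ → ℝ)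

end CutAndProjectScheme

open MeasureTheory Filter Topology Module

/-! If `diag(A, B)` is conjugate to an integer matrix `C`, the characteristic polynomial of `A`
divides that of `C`, which is monic and integral, so the eigenvalues of `A` are algebraic integers.

Conversely, let `h` be the minimal polynomial of `A` over `ℚ`. It has integer coefficients by
Gauss's lemma and is separable because `A` is diagonalizable. A scheme can be built from an integer
matrix `C` and real `P`, `S` with `AP = PC`, `CS = SA`, `PS = 1`: complete `P` to an invertible `L`
by rows `Q` whose kernel is the image of `S` (`exists_generic_scheme_of_intertwiners`). It is
generic once `Pz ≠ 0`, `SPz ≠ z` and `φS ≠ 0` for all nonzero integer vectors `z`, `φ`.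

For `C` take `n + 1` diagonal copies of the companion matrix of `h`. It is intertwined with `A` by
two families `p v`, `t l`, linear in their parameters, with `∑ p(e_a) t(e_a) = h'(A)`, which is
invertible by separability. Hence `n` copies suffice for `PS` to be invertible, and it can be
normalised to `1`. The last copy makes `s > n` and leaves room for `SPz ≠ z`. Choosing the
parameters one after another, each condition fails only on a proper affine subspace. There are
countably many conditions, so almost every parameter meets them all. -/

theorem ae_linearMap_add_const_ne_zero {F G : Type*} [NormedAddCommGroup F] [NormedSpace ℝ F]
    [FiniteDimensional ℝ F] [MeasurableSpace F] [BorelSpace F] (μ : Measure F)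
    [μ.IsAddHaarMeasure] [AddCommGroup G] [Module ℝ G] (f : F →ₗ[ℝ] G) (c : G)
    (h : ∃ x, f x + c ≠ 0) : ∀ᵐ x ∂μ, f x + c ≠ 0 := by
  let Z : AffineSubspace ℝ F :=
    (AffineSubspace.mk' (0 : G) ⊥).comap (f.toAffineMap + AffineMap.const ℝ F c)
  have hZ : ∀ x, x ∈ Z ↔ f x + c = 0 := fun x => by
    simp [Z, AffineSubspace.mem_comap, AffineSubspace.mem_mk']
  refine measure_mono_null (fun x hx => (hZ x).2 (not_not.1 hx))
    (Measure.addHaar_affineSubspace μ Z fun htop => ?_)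
  obtain ⟨x, hx⟩ := h
  exact hx ((hZ x).1 (htop ▸ AffineSubspace.mem_top ℝ F x))

/-! ### Density of subgroups of a real vector space, by duality. -/

section ClosedSubgroups

variable {E : Type*} [NormedAddCommGroup E] [NormedSpace ℝ E] [FiniteDimensional ℝ E]

/-- Otherwise nonzero `x k ∈ K` tend to `0`, with directions accumulating at a unit vector `u`. The
multiples `⌊t / ‖x k‖⌋ • x k` lie in `K` and are within `‖x k‖` of `t • x k / ‖x k‖`, so `t • u ∈ K`
for every `t`: the line through `u` lies in `K`. -/
theorem AddSubgroup.discreteTopology_of_isClosed (K : AddSubgroup E) (hK : IsClosed (K : Set E))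
    (hline : ∀ x, (∀ t : ℝ, t • x ∈ K) → x = 0) : DiscreteTopology K := by
  by_contra hd
  have hsmall : ∀ ε > 0, ∃ x ∈ K, x ≠ 0 ∧ ‖x‖ < ε := by
    by_contra! hε
    obtain ⟨ε, hε, h⟩ := hε
    refine hd (DiscreteTopology.of_forall_le_dist hε fun x y hxy => ?_)
    beta_reduce
    rw [Subtype.dist_eq, dist_eq_norm]
    exact h _ (K.sub_mem x.2 y.2) (sub_ne_zero.2 fun e => hxy (Subtype.ext e))
  choose x hxK hx0 hxlt using fun k : ℕ => hsmall (1 / ((k : ℝ) + 1)) (by positivity)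
  have hxlim : Tendsto (fun k => ‖x k‖) atTop (𝓝 0) :=
    squeeze_zero (fun _ => norm_nonneg _) (fun k => (hxlt k).le) tendsto_one_div_add_atTop_nhds_zero_nat
  have hpos : ∀ k, 0 < ‖x k‖ := fun k => norm_pos_iff.2 (hx0 k)
  have := FiniteDimensional.proper_real E
  obtain ⟨u, hu, φ, hφ, hlim⟩ := (isCompact_sphere (0 : E) 1).tendsto_subseq
    (x := fun k => ‖x k‖⁻¹ • x k) (fun k => by
      simp [norm_smul, inv_mul_cancel₀ (hpos k).ne'])
  have hu0 : u ≠ 0 := fun h => by simp [h] at hu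
  refine hu0 (hline u fun t => ?_)
  have hclose : Tendsto (fun k => Int.fract (t / ‖x (φ k)‖) • x (φ k)) atTop (𝓝 0) := by
    refine squeeze_zero_norm (fun k => ?_) (hxlim.comp hφ.tendsto_atTop)
    rw [norm_smul, Real.norm_of_nonneg (Int.fract_nonneg _)]
    exact mul_le_of_le_one_left (norm_nonneg _) (Int.fract_lt_one _).le
  have := (hlim.const_smul t).sub hclose
  rw [sub_zero] at this
  refine hK.mem_of_tendsto this (Eventually.of_forall fun k => ?_)
  have e : t • ((fun k => ‖x k‖⁻¹ • x k) ∘ φ) k - Int.fract (t / ‖x (φ k)‖) • x (φ k)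
      = ⌊t / ‖x (φ k)‖⌋ • x (φ k) := by
    rw [← Int.cast_smul_eq_zsmul ℝ, ← Int.self_sub_fract, sub_smul]
    simp [smul_smul, div_eq_mul_inv]
  rw [e]
  exact K.zsmul_mem (hxK _) _

theorem exists_integral_functional_of_discrete [Nontrivial E] (K : Submodule ℤ E)
    [DiscreteTopology K] :
    ∃ f : E →ₗ[ℝ] ℝ, f ≠ 0 ∧ ∀ x ∈ K, ∃ k : ℤ, f x = k := by
  by_cases hs : Submodule.span ℝ (K : Set E) = ⊤
  · have : IsZLattice ℝ K := ⟨hs⟩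
    let b := (Module.Free.chooseBasis ℤ K)
    let b' := b.ofZLatticeBasis ℝ K
    obtain ⟨i⟩ := b'.index_nonempty
    refine ⟨b'.coord i, fun h => ?_, fun x hx => ⟨b.repr ⟨x, hx⟩ i, ?_⟩⟩
    · simpa using LinearMap.congr_fun h (b' i)
    · exact b.ofZLatticeBasis_repr_apply ℝ K ⟨x, hx⟩ i
  · obtain ⟨f, hf, hle⟩ := Submodule.exists_le_ker_of_lt_top _ (lt_top_iff_ne_top.2 hs)
    exact ⟨f, hf, fun x hx => ⟨0, by simpa using hle (Submodule.subset_span hx)⟩⟩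

/-- Split off the largest subspace `K₀` of the closure `K`. On a complement `V` the group `K ∩ V`
contains no line, hence is discrete. If `V ≠ 0`, a nonzero functional integral on `K ∩ V`, composed
with the projection along `K₀`, is integral on `H`. -/
theorem AddSubgroup.dense_of_forall_functional (H : AddSubgroup E)
    (h : ∀ f : E →ₗ[ℝ] ℝ, (∀ x ∈ H, ∃ k : ℤ, f x = k) → f = 0) : Dense (H : Set E) := by
  set K := H.topologicalClosure with hKdef
  have hK : IsClosed (K : Set E) := H.isClosed_topologicalClosure
  let K₀ : Submodule ℝ E :=
    { carrier := {x | ∀ t : ℝ, t • x ∈ K}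
      zero_mem' := fun t => by simp [K.zero_mem]
      add_mem' := fun {x y} hx hy t => by rw [smul_add]; exact K.add_mem (hx t) (hy t)
      smul_mem' := fun c x hx t => by rw [smul_smul]; exact hx _ }
  have hK₀ : ∀ x ∈ K₀, x ∈ K := fun x hx => by simpa using hx 1
  obtain ⟨V, hV⟩ := K₀.exists_isCompl
  let K' : Submodule ℤ V := AddSubgroup.toIntSubmodule (K.comap V.subtype.toAddMonoidHom)
  have hmem : ∀ x : V, x ∈ K' ↔ (x : E) ∈ K := fun x => Iff.rfl
  have : DiscreteTopology K' :=
    AddSubgroup.discreteTopology_of_isClosed (K.comap V.subtype.toAddMonoidHom)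
      (hK.preimage continuous_subtype_val) fun x hx => by
        have : (x : E) ∈ K₀ ⊓ V := ⟨fun t => hx t, x.2⟩
        rw [hV.inf_eq_bot] at this
        exact Subtype.ext this
  rcases subsingleton_or_nontrivial V with hsub | hnt
  · have hbot : V = ⊥ := Submodule.subsingleton_iff_eq_bot.1 hsub
    intro x
    have : x ∈ K₀ ⊔ V := hV.sup_eq_top ▸ Submodule.mem_top
    rw [hbot, sup_bot_eq] at this
    exact hK₀ x this
  · obtain ⟨f, hf0, hf⟩ := exists_integral_functional_of_discrete K'
    refine absurd ?_ hf0
    have hzero := h (f ∘ₗ V.projectionOnto K₀ hV.symm) fun x hx => hf _ <| by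
      rw [hmem]
      have hdec : (V.projectionOnto K₀ hV.symm x : E)
          = x - K₀.projectionOnto V hV x := by
        rw [eq_sub_iff_add_eq, add_comm]
        exact Submodule.projection_add_projection_eq_self hV x
      rw [hdec]
      exact K.sub_mem (H.le_topologicalClosure hx) (hK₀ _ (Subtype.mem _))
    ext v
    simpa using LinearMap.congr_fun hzero (v : E)

end ClosedSubgroups

/-! ### Eigenvalues of a self-similarity are algebraic integers. -/

section Forward

open CutAndProjectScheme

theorem isIntegral_of_mem_spectrum_of_isSelfSimilarity {n m : ℕ} {Λ : CutAndProjectScheme n m}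
    {A : Matrix (Fin n) (Fin n) ℝ} (hA : Λ.IsSelfSimilarity A) {μ : ℂ}
    (hμ : μ ∈ spectrum ℂ (A.map (algebraMap ℝ ℂ))) : IsIntegral ℤ μ := by
  obtain ⟨-, L, ⟨hL, -⟩, C, B, h⟩ := hA
  have hchar : A.charpoly * B.charpoly = C.charpoly.map (Int.castRingHom ℝ) := by
    have hC : C.map (Int.cast : ℤ → ℝ) =
        (hL.unit⁻¹).val * Matrix.fromBlocks A 0 0 B * hL.unit.val := by
      rw [mul_assoc]
      change _ = _ * (_ * L)
      rw [h, ← mul_assoc, IsUnit.val_inv_mul, one_mul]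
    rw [← Matrix.charpoly_map]
    change _ = (C.map (Int.cast : ℤ → ℝ)).charpoly
    rw [hC, Matrix.coe_units_inv, Matrix.charpoly_units_conj', Matrix.charpoly_fromBlocks_zero₁₂]
  refine ⟨C.charpoly, C.charpoly_monic, ?_⟩
  rw [Matrix.mem_spectrum_iff_isRoot_charpoly, Matrix.charpoly_map, Polynomial.IsRoot,
    Polynomial.eval_map] at hμ
  have e : algebraMap ℤ ℂ = (algebraMap ℝ ℂ).comp (Int.castRingHom ℝ) := RingHom.ext_int _ _
  rw [e, ← Polynomial.eval₂_map, ← hchar, Polynomial.eval₂_mul, hμ, zero_mul]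

end Forward

/-! ### From intertwining matrices to a scheme. -/

section Construction

/-- `1 - S * P` projects onto `ker P` along the image of `S`; `Q` is this projection read in
coordinates of `ker P`, and `T` is the inclusion of `ker P`. -/
theorem Matrix.exists_complement_of_mul_eq_one {κ ι : Type*} [Fintype κ] [Fintype ι]
    [DecidableEq κ] [DecidableEq ι] {P : Matrix κ ι ℝ} {S : Matrix ι κ ℝ} (hPS : P * S = 1)
    {m : ℕ} (hm : Fintype.card κ + m = Fintype.card ι) :
    ∃ (Q : Matrix (Fin m) ι ℝ) (T : Matrix ι (Fin m) ℝ),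
      P * T = 0 ∧ Q * S = 0 ∧ Q * T = 1 ∧ S * P + T * Q = 1 := by
  have hPS' : ∀ x, P.mulVecLin (S.mulVecLin x) = x := fun x => by
    simp [Matrix.mulVec_mulVec, hPS]
  have hrange : LinearMap.range P.mulVecLin = ⊤ :=
    LinearMap.range_eq_top.2 fun x => ⟨_, hPS' x⟩
  set K := LinearMap.ker P.mulVecLin with hK
  have hrank : finrank ℝ K = m := by
    have := P.mulVecLin.finrank_range_add_finrank_ker
    rw [hrange, finrank_top, finrank_fintype_fun_eq_card, finrank_fintype_fun_eq_card, ← hK] at this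
    omega
  let e : K ≃ₗ[ℝ] (Fin m → ℝ) := LinearEquiv.ofFinrankEq _ _ (by simp [hrank])
  let R : (ι → ℝ) →ₗ[ℝ] K := (LinearMap.id - S.mulVecLin ∘ₗ P.mulVecLin).codRestrict K fun x => by
    rw [hK, LinearMap.mem_ker]
    simp [hPS, ← Matrix.mul_assoc, Matrix.mulVec_mulVec, Matrix.mulVec_sub]
  have hRK : ∀ x : K, R x = x := fun x => by
    ext1
    have hx : P.mulVecLin (x : ι → ℝ) = 0 := x.2
    change (x : ι → ℝ) - S.mulVecLin (P.mulVecLin x) = x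
    rw [hx, map_zero, sub_zero]
  have hRS : ∀ x, R (S.mulVecLin x) = 0 := fun x => by
    ext1
    change S.mulVecLin x - S.mulVecLin (P.mulVecLin (S.mulVecLin x)) = 0
    rw [hPS', sub_self]
  refine ⟨LinearMap.toMatrix' (e.toLinearMap ∘ₗ R),
    LinearMap.toMatrix' (K.subtype ∘ₗ e.symm.toLinearMap), ?_, ?_, ?_, ?_⟩ <;>
    apply Matrix.toLin'.injective <;>
    simp only [map_add, Matrix.toLin'_mul, Matrix.toLin'_toMatrix', Matrix.toLin'_one, map_zero] <;>
    refine LinearMap.ext fun x => ?_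
  · exact (e.symm x).2
  · exact (congrArg e (hRS x)).trans (map_zero e)
  · change e (R (e.symm x)) = x
    rw [hRK, e.apply_symm_apply]
  · change S.mulVecLin (P.mulVecLin x) + (e.symm (e (R x)) : ι → ℝ) = x
    rw [e.symm_apply_apply]
    exact add_sub_cancel _ _

/-- The lattice is the image of `ℤ^ι` under the rows of `P` and `Q`. Since `SP + TQ = 1`, `Qz = 0`
forces `SPz = z`, so `himage` gives aperiodicity; `hdual` gives density. -/
theorem exists_generic_scheme_of_intertwiners {n : ℕ} (hn : 1 ≤ n) {ι : Type*} [Fintype ι]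
    [DecidableEq ι] (hcard : n < Fintype.card ι) {A : Matrix (Fin n) (Fin n) ℝ}
    (C : Matrix ι ι ℤ) (P : Matrix (Fin n) ι ℝ) (S : Matrix ι (Fin n) ℝ)
    (hP : A * P = P * C.map (Int.cast : ℤ → ℝ)) (hS : C.map (Int.cast : ℤ → ℝ) * S = S * A)
    (hPS : P * S = 1)
    (hker : ∀ z : ι → ℤ, z ≠ 0 → P.mulVec (fun i => (z i : ℝ)) ≠ 0)
    (himage : ∀ z : ι → ℤ, z ≠ 0 →
      S.mulVec (P.mulVec fun i => (z i : ℝ)) ≠ fun i => (z i : ℝ))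
    (hdual : ∀ φ : ι → ℤ, φ ≠ 0 → Matrix.vecMul (fun i => (φ i : ℝ)) S ≠ 0) :
    ∃ (m : ℕ) (Λ : CutAndProjectScheme n m), Λ.Generic ∧ Λ.IsSelfSimilarity A := by
  obtain ⟨m, hm⟩ := Nat.exists_eq_add_of_lt hcard
  obtain ⟨Q, T, hPT, hQS, hQT, hsum⟩ := Matrix.exists_complement_of_mul_eq_one hPS (m := m + 1)
    (by simp; omega)
  set Cr := C.map (Int.cast : ℤ → ℝ) with hCr
  let e : Fin n ⊕ Fin (m + 1) ≃ ι := Fintype.equivOfCardEq (by simp; omega)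
  let L : Matrix (Fin n ⊕ Fin (m + 1)) (Fin n ⊕ Fin (m + 1)) ℝ :=
    (Matrix.fromRows P Q).submatrix id e
  have hLunit : IsUnit L := by
    refine (Matrix.isUnit_iff_isUnit_det _).2
      (Matrix.isUnit_det_of_right_inverse (B := (Matrix.fromCols S T).submatrix e id) ?_)
    rw [Matrix.submatrix_mul_equiv, Matrix.fromRows_mul_fromCols, hPS, hPT, hQS, hQT,
      Matrix.fromBlocks_one, Matrix.submatrix_id_id]
  let Λ : CutAndProjectScheme n (m + 1) :=
    ⟨hn, by omega, Submodule.span ℤ (Set.range fun j => L.col j), L, hLunit, rfl⟩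
  have hmem : ∀ x, x ∈ (Λ.lattice : Set (AmbientSpace n (m + 1))) ↔ ∃ z : ι → ℤ,
      x = Sum.elim (P.mulVec fun i => (z i : ℝ)) (Q.mulVec fun i => (z i : ℝ)) := by
    intro x
    change x ∈ Submodule.span ℤ (Set.range fun j => L.col j) ↔ _
    have key : ∀ c : Fin n ⊕ Fin (m + 1) → ℤ, ∑ j, c j • L.col j =
        Sum.elim (P.mulVec fun i => (c (e.symm i) : ℝ)) (Q.mulVec fun i => (c (e.symm i) : ℝ)) := by
      intro c
      have h1 : ∑ j, c j • L.col j =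
          (Matrix.fromRows P Q).mulVec fun i => (c (e.symm i) : ℝ) := by
        ext i
        rw [Finset.sum_apply, Matrix.mulVec, dotProduct, ← e.sum_comp]
        refine Finset.sum_congr rfl fun j _ => ?_
        simp [L, Matrix.col, mul_comm]
      rw [h1, Matrix.fromRows_mulVec]
    rw [Submodule.mem_span_range_iff_exists_fun]
    constructor
    · rintro ⟨c, rfl⟩
      exact ⟨fun i => c (e.symm i), key c⟩
    · rintro ⟨z, rfl⟩
      exact ⟨fun j => z (e j), by rw [key]; simp⟩
  have hPz : ∀ z : ι → ℤ, CutAndProjectScheme.projPar n (m + 1) (Sum.elim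
      (P.mulVec fun i => (z i : ℝ)) (Q.mulVec fun i => (z i : ℝ))) = P.mulVec fun i => (z i : ℝ) :=
    fun _ => rfl
  have hdec : ∀ x : ι → ℝ, S.mulVec (P.mulVec x) + T.mulVec (Q.mulVec x) = x := fun x => by
    rw [Matrix.mulVec_mulVec, Matrix.mulVec_mulVec, ← Matrix.add_mulVec, hsum, Matrix.one_mulVec]
  have hinj : ∀ {k : Type} (M : Matrix k ι ℝ),
      (∀ z : ι → ℤ, z ≠ 0 → M.mulVec (fun i => (z i : ℝ)) ≠ 0) →
      ∀ z w : ι → ℤ, M.mulVec (fun i => (z i : ℝ)) = M.mulVec (fun i => (w i : ℝ)) → z = w := by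
    intro k M hM z w h
    by_contra hzw
    refine hM (z - w) (sub_ne_zero.2 hzw) ?_
    have : (fun i => ((z - w) i : ℝ)) = (fun i => (z i : ℝ)) - fun i => (w i : ℝ) := by
      ext; simp
    rw [this, Matrix.mulVec_sub, h, sub_self]
  refine ⟨m + 1, Λ, ⟨?_, ?_, ?_⟩, ?_, L, ⟨hLunit, rfl⟩, C.submatrix e e, Q * Cr * T, ?_⟩
  · intro x hx y hy hxy
    obtain ⟨z, rfl⟩ := (hmem x).1 hx
    obtain ⟨w, rfl⟩ := (hmem y).1 hy
    rw [hinj P hker z w hxy]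
  · intro x hx y hy hxy
    obtain ⟨z, rfl⟩ := (hmem x).1 hx
    obtain ⟨w, rfl⟩ := (hmem y).1 hy
    rw [hinj Q (fun z hz h => himage z hz ?_) z w hxy]
    simpa [h] using hdec fun i => (z i : ℝ)
  · let H : AddSubgroup (Fin (m + 1) → ℝ) :=
      { carrier := Set.range fun z : ι → ℤ => Q.mulVec fun i => (z i : ℝ)
        zero_mem' := ⟨0, (congrArg Q.mulVec (funext fun _ => Int.cast_zero)).trans Q.mulVec_zero⟩
        add_mem' := by
          rintro _ _ ⟨z, rfl⟩ ⟨w, rfl⟩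
          refine ⟨z + w, ?_⟩
          beta_reduce
          rw [← Matrix.mulVec_add]
          congr 1
          ext; simp
        neg_mem' := by
          rintro _ ⟨z, rfl⟩
          refine ⟨-z, ?_⟩
          beta_reduce
          rw [← Matrix.mulVec_neg]
          congr 1
          ext; simp }
    have hH : Dense (H : Set (Fin (m + 1) → ℝ)) := by
      refine AddSubgroup.dense_of_forall_functional H fun f hf => ?_
      choose φ hφ using fun i : ι => hf (Q.mulVec (Pi.single i 1)) ⟨Pi.single i 1, by
        beta_reduce
        congr 1
        ext j
        by_cases h : j = i
        · subst h; simp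
        · simp [h]⟩
      have hlin : ∀ x : ι → ℝ, f (Q.mulVec x) = (fun i => (φ i : ℝ)) ⬝ᵥ x := by
        intro x
        conv_lhs => rw [pi_eq_sum_univ' x]
        rw [Matrix.mulVec_sum, map_sum, dotProduct]
        refine Finset.sum_congr rfl fun i _ => ?_
        rw [Matrix.mulVec_smul, map_smul, smul_eq_mul, mul_comm, ← hφ]
      -- The functional `f ∘ Q` has integer coefficients `φ` and kills the image of `S`, because `QS
      -- = 0`.
      have hφ0 : φ = 0 := by
        by_contra h
        refine hdual φ h (dotProduct_eq_zero _ fun y => ?_)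
        rw [← Matrix.dotProduct_mulVec, ← hlin, Matrix.mulVec_mulVec, hQS, Matrix.zero_mulVec,
          map_zero]
      refine LinearMap.ext fun x => ?_
      have hx : x = Q.mulVec (T.mulVec x) := by
        rw [Matrix.mulVec_mulVec, hQT, Matrix.one_mulVec]
      rw [hx, hlin, hφ0]
      simp
    suffices h : _ = (H : Set (Fin (m + 1) → ℝ)) from (congrArg Dense h).mpr hH
    ext y
    constructor
    · rintro ⟨x, hx, rfl⟩
      obtain ⟨z, rfl⟩ := (hmem x).1 hx
      exact ⟨z, rfl⟩
    · rintro ⟨z, rfl⟩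
      exact ⟨_, (hmem _).2 ⟨z, rfl⟩, rfl⟩
  · rintro _ ⟨x, hx, rfl⟩
    obtain ⟨z, rfl⟩ := (hmem x).1 hx
    refine ⟨_, (hmem _).2 ⟨C.mulVec z, rfl⟩, ?_⟩
    rw [hPz, hPz, Matrix.mulVec_mulVec, hP, ← Matrix.mulVec_mulVec]
    congr 1
    ext i
    simp [hCr, Matrix.mulVec, dotProduct]
  -- `C` preserves the image of `S`, which is `ker Q`, so it induces a map `B` on the internal
  -- space.
  · have hB : Q * Cr * T * Q = Q * Cr := by
      have : T * Q = 1 - S * P := eq_sub_of_add_eq' hsum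
      rw [Matrix.mul_assoc, this, Matrix.mul_sub, Matrix.mul_one, Matrix.mul_assoc Q,
        ← Matrix.mul_assoc Cr, hS, Matrix.mul_assoc S, ← Matrix.mul_assoc Q, hQS, Matrix.zero_mul,
        sub_zero]
    have h1 : Matrix.fromBlocks A 0 0 (Q * Cr * T) * Matrix.fromRows P Q
        = Matrix.fromRows P Q * Cr := by
      rw [Matrix.fromBlocks_mul_fromRows, Matrix.fromRows_mul, hB, hP]
      simp
    have h2 : (C.submatrix e e).map (Int.cast : ℤ → ℝ) = Cr.submatrix e e := rfl
    rw [h2]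
    change _ * (Matrix.fromRows P Q).submatrix id e = (Matrix.fromRows P Q).submatrix id e * _
    rw [Matrix.submatrix_mul_equiv, ← h1]
    rfl

end Construction

/-! ### The minimal polynomial is integral and separable. -/

section IntegralMinpoly

open Polynomial

variable {ι : Type*} [Fintype ι] [DecidableEq ι]

theorem Matrix.aeval_eq_zero_of_forall_eigenvalue {A : Matrix ι ι ℝ} {P : Matrix ι ι ℂ} {d : ι → ℂ}
    (hP : IsUnit P) (hd : A.map (algebraMap ℝ ℂ) * P = P * Matrix.diagonal d) {p : ℚ[X]}
    (hp : ∀ i, aeval (d i) p = 0) : aeval A p = 0 := by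
  have hcomm : ∀ q : ℚ[X], aeval (A.map (algebraMap ℝ ℂ)) q * P = P * aeval (Matrix.diagonal d) q := by
    intro q
    induction q using Polynomial.induction_on' with
    | add q r hq hr => simp only [map_add, add_mul, mul_add, hq, hr]
    | monomial k a =>
      have hpow : (A.map (algebraMap ℝ ℂ)) ^ k * P = P * Matrix.diagonal d ^ k :=
        (show SemiconjBy P (Matrix.diagonal d) (A.map (algebraMap ℝ ℂ)) from hd.symm).pow_right k
          |>.symm
      rw [aeval_monomial, aeval_monomial, mul_assoc, hpow, ← mul_assoc, ← mul_assoc,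
        Algebra.commutes]
  have hdiag : aeval (Matrix.diagonal d) p = 0 := by
    have h1 : aeval d p = 0 := by
      ext i
      change Pi.evalAlgHom ℚ (fun _ => ℂ) i (aeval d p) = 0
      rw [← aeval_algHom_apply]
      exact hp i
    change aeval (Matrix.diagonalAlgHom ℚ d) p = 0
    rw [aeval_algHom_apply, h1, map_zero]
  have hzero : aeval (A.map (algebraMap ℝ ℂ)) p = 0 := by
    have := hcomm p
    rw [hdiag, mul_zero] at this
    exact (hP.mul_left_eq_zero).1 this
  have hmap : (aeval A p).map (algebraMap ℝ ℂ) = 0 := by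
    rw [← hzero]
    exact (aeval_algHom_apply (((Algebra.ofId ℝ ℂ).restrictScalars ℚ).mapMatrix) A p).symm
  exact Matrix.map_injective (algebraMap ℝ ℂ).injective (hmap.trans (by ext; simp))

theorem exists_separable_integral_annihilator {A : Matrix ι ι ℝ}
    (hA : MatrixDiagonalizable (A.map (algebraMap ℝ ℂ)))
    (hint : ∀ μ ∈ spectrum ℂ (A.map (algebraMap ℝ ℂ)), IsIntegral ℤ μ) :
    ∃ h : ℤ[X], h.Monic ∧ aeval A h = 0 ∧ IsUnit (aeval A (derivative h)) ∧
      ∀ q : ℤ[X], q.degree < h.degree → aeval A q = 0 → q = 0 := by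
  obtain ⟨P, d, hP, hd⟩ := hA
  have hspec : ∀ i, IsIntegral ℤ (d i) := fun i => hint _ <| by
    have : A.map (algebraMap ℝ ℂ) = hP.unit.val * Matrix.diagonal d * (hP.unit⁻¹).val := by
      rw [IsUnit.unit_spec, ← hd, mul_assoc, IsUnit.mul_val_inv, mul_one]
    rw [this, spectrum.units_conjugate, spectrum_diagonal]
    exact ⟨i, rfl⟩
  let g₀ : ℤ[X] := ∏ i, minpoly ℤ (d i)
  have hg₀ : g₀.Monic := monic_prod_of_monic _ _ fun i _ => minpoly.monic (hspec i)
  let g : ℚ[X] := g₀.map (algebraMap ℤ ℚ)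
  have hg : g ≠ 0 := (hg₀.map _).ne_zero
  have hroot : ∀ i, aeval (d i) g = 0 := fun i => by
    rw [aeval_map_algebraMap, map_prod]
    exact Finset.prod_eq_zero (Finset.mem_univ i) (minpoly.aeval ℤ (d i))
  -- Diagonalizability enters here: the radical of `g` already annihilates `A`, so the minimal
  -- polynomial is squarefree.
  have hradroot : ∀ i, aeval (d i) (UniqueFactorizationMonoid.radical g) = 0 := fun i => by
    have hirr : Irreducible (minpoly ℚ (d i)) := minpoly.irreducible (hspec i).tower_top
    obtain ⟨q, hq⟩ := (UniqueFactorizationMonoid.dvd_radical_iff_of_irreducible hirr hg).2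
      (minpoly.dvd ℚ (d i) (hroot i))
    rw [hq, map_mul, minpoly.aeval, zero_mul]
  have hAg : aeval A g = 0 := Matrix.aeval_eq_zero_of_forall_eigenvalue hP hd hroot
  have hAint : IsIntegral ℚ A := ⟨g, hg₀.map _, hAg⟩
  have hsep : (minpoly ℚ A).Separable := PerfectField.separable_iff_squarefree.2 <|
    UniqueFactorizationMonoid.squarefree_radical.squarefree_of_dvd <|
      minpoly.dvd ℚ A (Matrix.aeval_eq_zero_of_forall_eigenvalue hP hd hradroot)
  obtain ⟨h, hh⟩ := IsIntegrallyClosed.eq_map_mul_C_of_dvd ℚ hg₀ (minpoly.dvd ℚ A hAg)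
  rw [(minpoly.monic hAint).leadingCoeff, C_1, mul_one] at hh
  refine ⟨h, ?_, ?_, ?_, fun q hdeg hq => ?_⟩
  · exact monic_of_injective (algebraMap ℤ ℚ).injective_int (hh ▸ minpoly.monic hAint)
  · rw [← aeval_map_algebraMap ℚ, hh, minpoly.aeval]
  · obtain ⟨a, b, hab⟩ := hsep
    have := congrArg (aeval A) hab
    rw [map_add, map_mul, map_mul, minpoly.aeval, mul_zero, zero_add, map_one, ← hh,
      derivative_map, aeval_map_algebraMap] at this
    have hc := (Commute.all b (derivative (minpoly ℚ A))).map (aeval A)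
    rw [← hh, derivative_map, aeval_map_algebraMap] at hc
    exact IsUnit.of_mul_eq_one _ (hc.eq ▸ this)
  · by_contra hq0
    have hinj : Function.Injective (algebraMap ℤ ℚ) := (algebraMap ℤ ℚ).injective_int
    have h1 : q.map (algebraMap ℤ ℚ) ≠ 0 := (Polynomial.map_ne_zero_iff hinj).2 hq0
    have h2 := minpoly.degree_le_of_ne_zero ℚ A h1 (by rw [aeval_map_algebraMap, hq])
    rw [← hh, degree_map_eq_of_injective hinj, degree_map_eq_of_injective hinj] at h2
    exact absurd hdeg h2.not_gt

end IntegralMinpoly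

/-! ### Adding one copy of `C` to reach genericity. -/

section Generic

/-- With `P = [P₁, p v]` and `S = [S₁(1 - p v t l); t l]` the identity `PS = 1` holds for all `v`,
`l`, so both stay free. First `v` is chosen for injectivity of `P`, then `l`, in which `S` is
affine, for the other two conditions. -/
theorem exists_generic_scheme_of_retraction {n d : ℕ} (hn : 1 ≤ n) (hd : 0 < d)
    {A : Matrix (Fin n) (Fin n) ℝ}
    {C : Matrix (Fin d) (Fin d) ℤ} (p : (Fin n → ℝ) →ₗ[ℝ] Matrix (Fin n) (Fin d) ℝ)
    (t : (Fin n → ℝ) →ₗ[ℝ] Matrix (Fin d) (Fin n) ℝ)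
    (hp : ∀ v, A * p v = p v * C.map (Int.cast : ℤ → ℝ))
    (ht : ∀ l, C.map (Int.cast : ℤ → ℝ) * t l = t l * A)
    (hpz : ∀ z : Fin d → ℤ, z ≠ 0 → ∃ v, (p v).mulVec (fun i => (z i : ℝ)) ≠ 0)
    (htφ : ∀ φ : Fin d → ℤ, φ ≠ 0 → ∃ l, Matrix.vecMul (fun i => (φ i : ℝ)) (t l) ≠ 0)
    (htx : ∀ x, x ≠ 0 → ∃ l, (t l).mulVec x ≠ 0)
    {ι : Type*} [Fintype ι] [DecidableEq ι] (hι : n ≤ Fintype.card ι) {C₁ : Matrix ι ι ℤ}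
    {P₁ : Matrix (Fin n) ι ℝ} {S₁ : Matrix ι (Fin n) ℝ}
    (hP₁ : A * P₁ = P₁ * C₁.map (Int.cast : ℤ → ℝ)) (hS₁ : C₁.map (Int.cast : ℤ → ℝ) * S₁ = S₁ * A)
    (hPS₁ : P₁ * S₁ = 1) (hker : ∀ z : ι → ℤ, z ≠ 0 → P₁.mulVec (fun i => (z i : ℝ)) ≠ 0)
    (hdual : ∀ φ : ι → ℤ, φ ≠ 0 → Matrix.vecMul (fun i => (φ i : ℝ)) S₁ ≠ 0) :
    ∃ (m : ℕ) (Λ : CutAndProjectScheme n m), Λ.Generic ∧ Λ.IsSelfSimilarity A := by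
  have hsplit : ∀ z : ι ⊕ Fin d → ℤ, z ≠ 0 → z ∘ Sum.inl = 0 → z ∘ Sum.inr ≠ 0 := by
    intro z hz h1 h2
    refine hz (funext fun i => ?_)
    rcases i with i | i
    · exact congrFun h1 i
    · exact congrFun h2 i
  -- a second coordinate of the projection making it injective on the lattice
  have hv : ∀ᵐ v : Fin n → ℝ, ∀ z : {z : ι ⊕ Fin d → ℤ // z ≠ 0},
      (p v).mulVec (fun i => (z.1 (Sum.inr i) : ℝ)) +
        P₁.mulVec (fun i => (z.1 (Sum.inl i) : ℝ)) ≠ 0 := by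
    refine ae_all_iff.2 fun z => ?_
    let f : (Fin n → ℝ) →ₗ[ℝ] (Fin n → ℝ) :=
      { toFun := fun v => (p v).mulVec (fun i => (z.1 (Sum.inr i) : ℝ))
        map_add' := fun v w => by rw [map_add, Matrix.add_mulVec]
        map_smul' := fun c v => by rw [map_smul, Matrix.smul_mulVec]; rfl }
    refine ae_linearMap_add_const_ne_zero volume f _ ?_
    by_cases h1 : z.1 ∘ Sum.inl = 0
    · obtain ⟨v, hv⟩ := hpz _ (hsplit z.1 z.2 h1)
      refine ⟨v, ?_⟩
      have : P₁.mulVec (fun i => (z.1 (Sum.inl i) : ℝ)) = 0 := by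
        rw [← P₁.mulVec_zero]
        congr 1
        ext i
        simpa using congrFun h1 i
      rw [this, add_zero]
      exact hv
    · refine ⟨0, ?_⟩
      rw [map_zero, zero_add]
      exact hker _ h1
  obtain ⟨v, hv⟩ := hv.exists
  set P := Matrix.fromCols P₁ (p v) with hPdef
  have hPz : ∀ z : ι ⊕ Fin d → ℤ, z ≠ 0 → P.mulVec (fun i => (z i : ℝ)) ≠ 0 := by
    intro z hz
    have := hv ⟨z, hz⟩
    rwa [add_comm, ← Matrix.fromCols_mulVec_sumElim, show (Sum.elim (fun i => (z (Sum.inl i) : ℝ))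
      fun i => (z (Sum.inr i) : ℝ)) = fun i => (z i : ℝ) by ext (i | i) <;> rfl] at this
  have hl₁ : ∀ᵐ l : Fin n → ℝ, ∀ z : {z : ι ⊕ Fin d → ℤ // z ≠ 0},
      (t l).mulVec (P.mulVec fun i => (z.1 i : ℝ)) + -(fun i => (z.1 (Sum.inr i) : ℝ)) ≠ 0 := by
    refine ae_all_iff.2 fun z => ?_
    let f : (Fin n → ℝ) →ₗ[ℝ] (Fin d → ℝ) :=
      { toFun := fun l => (t l).mulVec (P.mulVec fun i => (z.1 i : ℝ))
        map_add' := fun v w => by rw [map_add, Matrix.add_mulVec]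
        map_smul' := fun c v => by rw [map_smul, Matrix.smul_mulVec]; rfl }
    refine ae_linearMap_add_const_ne_zero volume f _ ?_
    -- Only the lower block of `SPz = z` is used. If it held for all `l`, then `l = 0` would give a
    -- zero right side, so every `t l` would kill `Pz ≠ 0`.
    by_contra! hcon
    have h0 := hcon 0
    rw [map_zero, zero_add] at h0
    obtain ⟨l, hl⟩ := htx _ (hPz z.1 z.2)
    have := hcon l
    rw [h0, add_zero] at this
    exact hl this
  have hl₂ : ∀ᵐ l : Fin n → ℝ, ∀ φ : {φ : ι ⊕ Fin d → ℤ // φ ≠ 0},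
      Matrix.vecMul ((fun i => (φ.1 (Sum.inr i) : ℝ)) -
        Matrix.vecMul (Matrix.vecMul (fun i => (φ.1 (Sum.inl i) : ℝ)) S₁) (p v)) (t l) +
        Matrix.vecMul (fun i => (φ.1 (Sum.inl i) : ℝ)) S₁ ≠ 0 := by
    refine ae_all_iff.2 fun φ => ?_
    let f : (Fin n → ℝ) →ₗ[ℝ] (Fin n → ℝ) :=
      { toFun := fun l => Matrix.vecMul ((fun i => (φ.1 (Sum.inr i) : ℝ)) -
          Matrix.vecMul (Matrix.vecMul (fun i => (φ.1 (Sum.inl i) : ℝ)) S₁) (p v)) (t l)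
        map_add' := fun v w => by rw [map_add, Matrix.vecMul_add]
        map_smul' := fun c v => by rw [map_smul, Matrix.vecMul_smul]; rfl }
    refine ae_linearMap_add_const_ne_zero volume f _ ?_
    by_cases h1 : φ.1 ∘ Sum.inl = 0
    · obtain ⟨l, hl⟩ := htφ _ (hsplit φ.1 φ.2 h1)
      refine ⟨l, ?_⟩
      have h0 : Matrix.vecMul (fun i => (φ.1 (Sum.inl i) : ℝ)) S₁ = 0 := by
        rw [← S₁.zero_vecMul]
        congr 1
        ext i
        simpa using congrFun h1 i
      change Matrix.vecMul (_ - Matrix.vecMul (Matrix.vecMul _ S₁) (p v)) (t l) + _ ≠ 0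
      rw [h0, Matrix.zero_vecMul, sub_zero, add_zero]
      exact hl
    · refine ⟨0, ?_⟩
      rw [map_zero, zero_add]
      exact hdual _ h1
  obtain ⟨l, hl₁, hl₂⟩ := (hl₁.and hl₂).exists
  have hcomm : A * (1 - p v * t l) = (1 - p v * t l) * A := by
    rw [mul_sub, sub_mul, ← Matrix.mul_assoc, hp, Matrix.mul_assoc, ht, Matrix.mul_assoc]
    simp
  refine exists_generic_scheme_of_intertwiners hn (ι := ι ⊕ Fin d) (by simp; omega)
    (Matrix.fromBlocks C₁ 0 0 C) P (Matrix.fromRows (S₁ * (1 - p v * t l)) (t l))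
    ?_ ?_ ?_ hPz ?_ ?_
  · rw [Matrix.fromBlocks_map, hPdef, Matrix.mul_fromCols, Matrix.fromCols_mul_fromBlocks, hP₁, hp]
    simp [Matrix.map_zero]
  · rw [Matrix.fromBlocks_map, Matrix.fromRows_mul, Matrix.fromBlocks_mul_fromRows,
      ← Matrix.mul_assoc, hS₁, ht, Matrix.mul_assoc, hcomm, Matrix.mul_assoc]
    simp [Matrix.map_zero]
  · rw [hPdef, Matrix.fromCols_mul_fromRows, ← Matrix.mul_assoc, hPS₁, Matrix.one_mul,
      sub_add_cancel]
  · intro z hz h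
    refine hl₁ ⟨z, hz⟩ ?_
    rw [Matrix.fromRows_mulVec] at h
    rw [add_neg_eq_zero]
    funext i
    exact congrFun h (Sum.inr i)
  · intro φ hφ h
    refine hl₂ ⟨φ, hφ⟩ ?_
    rw [← h, Matrix.vecMul_fromRows, ← Matrix.vecMul_vecMul, Matrix.vecMul_sub, Matrix.vecMul_one,
      Matrix.sub_vecMul, ← Matrix.vecMul_vecMul]
    change _ = Matrix.vecMul (fun i => (φ (Sum.inl i) : ℝ)) S₁ - Matrix.vecMul (Matrix.vecMul
      (Matrix.vecMul (fun i => (φ (Sum.inl i) : ℝ)) S₁) (p v)) (t l) +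
      Matrix.vecMul (fun i => (φ (Sum.inr i) : ℝ)) (t l)
    abel

end Generic

/-! ### Making `P₁ S₁` invertible with `n` copies of `C`. -/

section Families

theorem exists_generic_scheme_of_intertwiner_families {n d : ℕ} (hn : 1 ≤ n) (hd : 0 < d)
    {A : Matrix (Fin n) (Fin n) ℝ}
    {C : Matrix (Fin d) (Fin d) ℤ} (p : (Fin n → ℝ) →ₗ[ℝ] Matrix (Fin n) (Fin d) ℝ)
    (t : (Fin n → ℝ) →ₗ[ℝ] Matrix (Fin d) (Fin n) ℝ)
    (hp : ∀ v, A * p v = p v * C.map (Int.cast : ℤ → ℝ))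
    (ht : ∀ l, C.map (Int.cast : ℤ → ℝ) * t l = t l * A)
    (hpz : ∀ z : Fin d → ℤ, z ≠ 0 → ∃ v, (p v).mulVec (fun i => (z i : ℝ)) ≠ 0)
    (htφ : ∀ φ : Fin d → ℤ, φ ≠ 0 → ∃ l, Matrix.vecMul (fun i => (φ i : ℝ)) (t l) ≠ 0)
    (htx : ∀ x, x ≠ 0 → ∃ l, (t l).mulVec x ≠ 0)
    (hunit : IsUnit (∑ a : Fin n, p (Pi.single a 1) * t (Pi.single a 1))) :
    ∃ (m : ℕ) (Λ : CutAndProjectScheme n m), Λ.Generic ∧ Λ.IsSelfSimilarity A := by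
  let P₁ : (Fin n → Fin n → ℝ) → Matrix (Fin n) (Fin d × Fin n) ℝ :=
    fun v => Matrix.of fun x ja => p (v ja.2) x ja.1
  let S₁ : (Fin n → Fin n → ℝ) → Matrix (Fin d × Fin n) (Fin n) ℝ :=
    fun l => Matrix.of fun ja x => t (l ja.2) ja.1 x
  have hP₁z : ∀ v z, (P₁ v).mulVec z = ∑ a, (p (v a)).mulVec fun j => z (j, a) := by
    intro v z
    ext x
    simp only [Matrix.mulVec, dotProduct, Fintype.sum_prod_type, Finset.sum_apply]
    exact Finset.sum_comm
  have hS₁φ : ∀ l φ, Matrix.vecMul φ (S₁ l) = ∑ a, Matrix.vecMul (fun j => φ (j, a)) (t (l a)) := by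
    intro l φ
    ext x
    simp only [Matrix.vecMul, dotProduct, Fintype.sum_prod_type, Finset.sum_apply]
    exact Finset.sum_comm
  have hPS : ∀ v l, P₁ v * S₁ l = ∑ a, p (v a) * t (l a) := by
    intro v l
    ext x y
    rw [Matrix.sum_apply]
    simp only [Matrix.mul_apply, Fintype.sum_prod_type]
    exact Finset.sum_comm
  set C₁ : Matrix (Fin d × Fin n) (Fin d × Fin n) ℤ := Matrix.blockDiagonal fun _ => C with hC₁
  have hC₁map : C₁.map (Int.cast : ℤ → ℝ) =
      Matrix.blockDiagonal fun _ : Fin n => C.map (Int.cast : ℤ → ℝ) :=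
    Matrix.blockDiagonal_map _ _ Int.cast_zero
  have hAP : ∀ v, A * P₁ v = P₁ v * C₁.map (Int.cast : ℤ → ℝ) := by
    intro v
    ext x ⟨j, a⟩
    have := congrFun (congrFun (hp (v a)) x) j
    rw [Matrix.mul_apply, Matrix.mul_apply] at this
    rw [hC₁map, Matrix.mul_apply, Matrix.mul_apply, Fintype.sum_prod_type]
    simpa [P₁, Matrix.blockDiagonal_apply] using this
  have hAS : ∀ l, C₁.map (Int.cast : ℤ → ℝ) * S₁ l = S₁ l * A := by
    intro l
    ext ⟨j, a⟩ x
    have := congrFun (congrFun (ht (l a)) j) x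
    rw [Matrix.mul_apply, Matrix.mul_apply] at this
    rw [hC₁map, Matrix.mul_apply, Matrix.mul_apply, Fintype.sum_prod_type]
    simpa [S₁, Matrix.blockDiagonal_apply] using this
  have hpcont : Continuous p := p.continuous_of_finiteDimensional
  have htcont : Continuous t := t.continuous_of_finiteDimensional
  let e : Fin n → Fin n → ℝ := fun a => Pi.single a 1
  have hdet : (∑ a, p (e a) * t (e a)).det ≠ 0 :=
    ((Matrix.isUnit_iff_isUnit_det _).1 hunit).ne_zero
  have hvae : ∀ᵐ v : Fin n → Fin n → ℝ, ∀ z : {z : Fin d × Fin n → ℤ // z ≠ 0},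
      (P₁ v).mulVec (fun i => (z.1 i : ℝ)) + 0 ≠ 0 := by
    refine ae_all_iff.2 fun z => ?_
    let f : (Fin n → Fin n → ℝ) →ₗ[ℝ] (Fin n → ℝ) :=
      { toFun := fun v => (P₁ v).mulVec (fun i => (z.1 i : ℝ))
        map_add' := fun v w => by
          simp only [hP₁z, Pi.add_apply, map_add, Matrix.add_mulVec, Finset.sum_add_distrib]
        map_smul' := fun c v => by
          simp only [hP₁z, Pi.smul_apply, map_smul, Matrix.smul_mulVec, Finset.smul_sum,
            RingHom.id_apply] }
    refine ae_linearMap_add_const_ne_zero volume f _ ?_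
    obtain ⟨⟨j, a⟩, hja⟩ := Function.ne_iff.1 z.2
    obtain ⟨v, hv⟩ := hpz (fun j => z.1 (j, a)) (Function.ne_iff.2 ⟨j, hja⟩)
    refine ⟨Pi.single a v, ?_⟩
    change (P₁ (Pi.single a v)).mulVec _ + 0 ≠ 0
    rw [add_zero, hP₁z, Finset.sum_eq_single a]
    · simpa using hv
    · intro b _ hb
      simp [hb]
    · simp
  have hlae : ∀ᵐ l : Fin n → Fin n → ℝ, ∀ φ : {φ : Fin d × Fin n → ℤ // φ ≠ 0},
      Matrix.vecMul (fun i => (φ.1 i : ℝ)) (S₁ l) + 0 ≠ 0 := by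
    refine ae_all_iff.2 fun φ => ?_
    let f : (Fin n → Fin n → ℝ) →ₗ[ℝ] (Fin n → ℝ) :=
      { toFun := fun l => Matrix.vecMul (fun i => (φ.1 i : ℝ)) (S₁ l)
        map_add' := fun v w => by
          simp only [hS₁φ, Pi.add_apply, map_add, Matrix.vecMul_add, Finset.sum_add_distrib]
        map_smul' := fun c v => by
          simp only [hS₁φ, Pi.smul_apply, map_smul, Matrix.vecMul_smul, Finset.smul_sum,
            RingHom.id_apply] }
    refine ae_linearMap_add_const_ne_zero volume f _ ?_
    obtain ⟨⟨j, a⟩, hja⟩ := Function.ne_iff.1 φ.2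
    obtain ⟨l, hl⟩ := htφ (fun j => φ.1 (j, a)) (Function.ne_iff.2 ⟨j, hja⟩)
    refine ⟨Pi.single a l, ?_⟩
    change Matrix.vecMul _ (S₁ (Pi.single a l)) + 0 ≠ 0
    rw [add_zero, hS₁φ, Finset.sum_eq_single a]
    · simpa using hl
    · intro b _ hb
      simp [hb]
    · simp
  -- The determinant is nonzero at the standard basis `(e, e)`. Moving `v` first and `l` second,
  -- each within an open set, keeps it nonzero while the countably many linear conditions are met.
  obtain ⟨v, hvdet, hv⟩ := (Measure.dense_of_ae hvae).exists_mem_open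
    (U := {v | (∑ a, p (v a) * t (e a)).det ≠ 0})
    (isOpen_ne_fun (Continuous.matrix_det <| continuous_finsetSum _ fun a _ =>
      (hpcont.comp (continuous_apply a)).matrix_mul continuous_const) continuous_const) ⟨e, hdet⟩
  obtain ⟨l, hldet, hl⟩ := (Measure.dense_of_ae hlae).exists_mem_open
    (U := {l | (∑ a, p (v a) * t (l a)).det ≠ 0})
    (isOpen_ne_fun (Continuous.matrix_det <| continuous_finsetSum _ fun a _ =>
      continuous_const.matrix_mul (htcont.comp (continuous_apply a))) continuous_const) ⟨e, hv⟩
  have hG : IsUnit (P₁ v * S₁ l) := by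
    rw [hPS]
    exact (Matrix.isUnit_iff_isUnit_det _).2 hl.isUnit
  obtain ⟨u, hu⟩ := hG
  have hAu : Commute A u.val := by
    rw [hu, commute_iff_eq, ← Matrix.mul_assoc, hAP, Matrix.mul_assoc, hAS, Matrix.mul_assoc]
  have hAu' : A * (u⁻¹).val = (u⁻¹).val * A := hAu.units_inv_right
  -- `u = P₁ S₁` commutes with `A`, so `S₁ u⁻¹` is still an intertwiner.
  refine exists_generic_scheme_of_retraction hn hd p t hp ht hpz htφ htx (ι := Fin d × Fin n)
    (by simpa using Nat.le_mul_of_pos_left n hd) (hAP v) (S₁ := S₁ l * (u⁻¹).val) ?_ ?_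
    (fun z hz => by simpa using hvdet ⟨z, hz⟩) fun φ hφ h => ?_
  · rw [← Matrix.mul_assoc, hAS, Matrix.mul_assoc, hAu', Matrix.mul_assoc]
  · rw [← Matrix.mul_assoc, ← hu, Units.mul_inv]
  · refine hldet ⟨φ, hφ⟩ ?_
    have h2 := congrArg (fun w => Matrix.vecMul w u.val) h
    simpa [Matrix.vecMul_vecMul, Matrix.mul_assoc] using h2


end Families

/-! ### Companion matrix intertwiners and Euler's identity for `h'`. -/

section Companion

open Polynomial

theorem Polynomial.coeff_iterate_divX {R : Type*} [Semiring R] (h : R[X]) (k j : ℕ) :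
    (divX^[k] h).coeff j = h.coeff (j + k) := by
  induction k generalizing j with
  | zero => rfl
  | succ k ih => rw [Function.iterate_succ_apply', coeff_divX, ih, add_right_comm, add_assoc]

theorem exists_companion_intertwiners {n : ℕ} (hn : 1 ≤ n) {A : Matrix (Fin n) (Fin n) ℝ}
    {h : ℤ[X]} (hmonic : h.Monic) (hA : aeval A h = 0) (hunit : IsUnit (aeval A (derivative h)))
    (hmin : ∀ q : ℤ[X], q.degree < h.degree → aeval A q = 0 → q = 0) :
    ∃ (d : ℕ) (C : Matrix (Fin d) (Fin d) ℤ) (p : (Fin n → ℝ) →ₗ[ℝ] Matrix (Fin n) (Fin d) ℝ)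
      (t : (Fin n → ℝ) →ₗ[ℝ] Matrix (Fin d) (Fin n) ℝ), 0 < d ∧
      (∀ v, A * p v = p v * C.map (Int.cast : ℤ → ℝ)) ∧
      (∀ l, C.map (Int.cast : ℤ → ℝ) * t l = t l * A) ∧
      (∀ z : Fin d → ℤ, z ≠ 0 → ∃ v, (p v).mulVec (fun i => (z i : ℝ)) ≠ 0) ∧
      (∀ φ : Fin d → ℤ, φ ≠ 0 → ∃ l, Matrix.vecMul (fun i => (φ i : ℝ)) (t l) ≠ 0) ∧
      (∀ x, x ≠ 0 → ∃ l, (t l).mulVec x ≠ 0) ∧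
      IsUnit (∑ a : Fin n, p (Pi.single a 1) * t (Pi.single a 1)) := by
  have hnt : Nonempty (Fin n) := ⟨⟨0, hn⟩⟩
  obtain ⟨e, he⟩ : ∃ e, h.natDegree = e + 1 := by
    refine Nat.exists_eq_succ_of_ne_zero fun h0 => ?_
    rw [hmonic.natDegree_eq_zero.1 h0, map_one] at hA
    exact one_ne_zero hA
  have hdeg : h.degree = ((e + 1 : ℕ) : WithBot ℕ) := by
    rw [degree_eq_natDegree hmonic.ne_zero, he]
  have hlead : h.coeff (e + 1) = 1 := he ▸ hmonic
  have hlarge : ∀ k, e + 1 < k → h.coeff k = 0 := fun k hk => coeff_eq_zero_of_natDegree_lt (he ▸ hk)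
  -- Horner quotients of `h`: the `β (i + 1)` for `i ≤ e` are, up to scaling by `h'`, the dual basis
  -- of the powers `X ^ i` modulo `h`.
  let β : ℕ → ℤ[X] := fun k => divX^[k] h
  have hβ : ∀ k j, (β k).coeff j = h.coeff (j + k) := fun k j => coeff_iterate_divX h k j
  have hβtop : β (e + 1) = 1 := by
    ext j
    rw [hβ, coeff_one]
    rcases Nat.eq_zero_or_pos j with rfl | hj
    · simpa using hlead
    · rw [hlarge _ (by omega), if_neg hj.ne']
  let M : ℕ → Matrix (Fin n) (Fin n) ℝ := fun k => aeval A (β k)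
  have hM0 : M 0 = 0 := hA
  have hMtop : M (e + 1) = 1 := by
    change aeval A (β (e + 1)) = 1
    rw [hβtop, map_one]
  have hMrec : ∀ k, M (k + 1) * A = M k - (h.coeff k : ℝ) • (1 : Matrix (Fin n) (Fin n) ℝ) := by
    intro k
    have h1 : β (k + 1) * X + Polynomial.C (h.coeff k) = β k := by
      have := divX_mul_X_add (β k)
      rw [hβ, zero_add] at this
      rwa [← Function.iterate_succ_apply' divX k h] at this
    have h2 := congrArg (aeval A) h1
    rw [map_add, map_mul, aeval_X, aeval_C] at h2
    rw [eq_sub_iff_add_eq, Int.cast_smul_eq_zsmul, ← Algebra.algebraMap_eq_smul_one]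
    exact h2
  have hAsum : ∑ i : Fin (e + 1), (h.coeff i : ℝ) • A ^ (i : ℕ) = -A ^ (e + 1) := by
    rw [eq_neg_iff_add_eq_zero, ← hA, aeval_eq_sum_range, he, Finset.sum_range_succ, hlead, one_smul,
      Finset.sum_range]
    simp only [Int.cast_smul_eq_zsmul]
  -- Multiplication by `X` modulo `h` in the basis of powers. The vectors `A ^ j v` follow it by
  -- `h(A) = 0`, the rows `l M (i + 1)` by the Horner recursion, with boundary values `M 0 = 0` and
  -- `M (e + 1) = 1`.
  let C : Matrix (Fin (e + 1)) (Fin (e + 1)) ℤ := Matrix.of fun i j =>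
    (if (i : ℕ) = j + 1 then 1 else 0) - (if j = Fin.last e then h.coeff i else 0)
  have hC : ∀ i j, C.map (Int.cast : ℤ → ℝ) i j =
      (if (i : ℕ) = j + 1 then 1 else 0) - (if j = Fin.last e then (h.coeff i : ℝ) else 0) := by
    intro i j
    simp only [C, Matrix.map_apply, Matrix.of_apply]
    push_cast
    rfl
  let p : (Fin n → ℝ) →ₗ[ℝ] Matrix (Fin n) (Fin (e + 1)) ℝ :=
    { toFun := fun v => Matrix.of fun x j => (A ^ (j : ℕ)).mulVec v x
      map_add' := fun v w => by ext; simp [Matrix.mulVec_add]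
      map_smul' := fun c v => by ext; simp [Matrix.mulVec_smul] }
  let t : (Fin n → ℝ) →ₗ[ℝ] Matrix (Fin (e + 1)) (Fin n) ℝ :=
    { toFun := fun l => Matrix.of fun i => Matrix.vecMul l (M (i + 1))
      map_add' := fun v w => by ext; simp [Matrix.add_vecMul]
      map_smul' := fun c v => by ext; simp [Matrix.smul_vecMul] }
  have hpA : ∀ v x j, p v x j = (A ^ (j : ℕ)).mulVec v x := fun _ _ _ => rfl
  have htM : ∀ l i, t l i = Matrix.vecMul l (M (i + 1)) := fun _ _ => rfl
  have hne : ∀ B : Matrix (Fin n) (Fin n) ℝ, (∀ v, B.mulVec v = 0) → B = 0 := fun B hB =>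
    Matrix.ext_iff_mulVec.2 fun v => by rw [hB, Matrix.zero_mulVec]
  have hne' : ∀ B : Matrix (Fin n) (Fin n) ℝ, (∀ v, Matrix.vecMul v B = 0) → B = 0 := fun B hB =>
    Matrix.transpose_injective (hne _ fun v => by rw [Matrix.mulVec_transpose, hB])
  refine ⟨e + 1, C, p, t, e.succ_pos, fun v => ?_, fun l => ?_, fun z hz => ?_, fun φ hφ => ?_,
    fun x hx => ?_, ?_⟩
  · ext x j
    have hcol : (A * p v) x j = (A ^ ((j : ℕ) + 1)).mulVec v x := by
      rw [pow_succ', ← Matrix.mulVec_mulVec]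
      rfl
    rw [hcol, Matrix.mul_apply]
    simp only [hC, mul_sub, mul_ite, mul_one, mul_zero, Finset.sum_sub_distrib, hpA]
    induction j using Fin.lastCases with
    | last =>
      have h1 := congrArg (fun B : Matrix (Fin n) (Fin n) ℝ => B.mulVec v x) hAsum
      simp only [Matrix.sum_mulVec, Finset.sum_apply, Matrix.smul_mulVec, Pi.smul_apply, smul_eq_mul,
        Matrix.neg_mulVec, Pi.neg_apply] at h1
      rw [Finset.sum_eq_zero fun i _ => if_neg (by rw [Fin.val_last]; exact i.2.ne)]
      simp only [if_true, Fin.val_last, zero_sub]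
      rw [← neg_eq_iff_eq_neg.2 h1]
      simp only [mul_comm]
    | cast j =>
      rw [Finset.sum_eq_single j.succ (fun i _ hi => if_neg fun h => hi (Fin.ext (by simpa using h)))
        (by simp)]
      simp [Fin.castSucc_ne_last]
  · ext i x
    have hrow : (t l * A) i x = Matrix.vecMul l (M i) x - h.coeff i * l x := by
      have : (t l * A) i = Matrix.vecMul (Matrix.vecMul l (M (i + 1))) A := rfl
      rw [this, Matrix.vecMul_vecMul, hMrec, Matrix.vecMul_sub, Matrix.vecMul_smul, Matrix.vecMul_one]
      rfl
    rw [hrow, Matrix.mul_apply]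
    simp only [hC, sub_mul, ite_mul, one_mul, zero_mul, Finset.sum_sub_distrib, htM]
    congr 1
    · induction i using Fin.cases with
      | zero => simp [hM0]
      | succ i =>
        rw [Finset.sum_eq_single i.castSucc
          (fun j _ hj => if_neg fun h => hj (Fin.ext (by simpa using h.symm))) (by simp)]
        simp
    · simp [hMtop]
  · by_contra! hcon
    refine hz ?_
    let q : ℤ[X] := ∑ j : Fin (e + 1), Polynomial.C (z j) * X ^ (j : ℕ)
    have hq0 : q = 0 := by
      refine hmin q (hdeg ▸ degree_sum_fin_lt z) (hne _ fun v => ?_)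
      have hq : aeval A q = ∑ j : Fin (e + 1), (z j : ℝ) • A ^ (j : ℕ) := by
        simp [q, Int.cast_smul_eq_zsmul]
      rw [hq, ← hcon v, Matrix.sum_mulVec]
      ext x
      rw [Finset.sum_apply, Matrix.mulVec, dotProduct]
      simp only [Matrix.smul_mulVec, Pi.smul_apply, smul_eq_mul, hpA, mul_comm]
    funext j
    have := congrArg (fun r => r.coeff j) hq0
    simpa [q, finsetSum_coeff, coeff_C_mul, coeff_X_pow, Fin.val_inj] using this
  · by_contra! hcon
    refine hφ ?_
    let r : ℤ[X] := ∑ i : Fin (e + 1), Polynomial.C (φ i) * β (i + 1)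
    have hrcoeff : ∀ k, r.coeff k = ∑ i : Fin (e + 1), φ i * h.coeff (k + (i + 1)) := fun k => by
      simp [r, hβ]
    have hr0 : r = 0 := by
      refine hmin r ?_ (hne' _ fun l => ?_)
      · rw [hdeg, degree_lt_iff_coeff_zero]
        intro k hk
        rw [hrcoeff]
        exact Finset.sum_eq_zero fun i _ => by rw [hlarge _ (by omega), mul_zero]
      · have hr : aeval A r = ∑ i : Fin (e + 1), (φ i : ℝ) • M (i + 1) := by
          simp [r, M, Int.cast_smul_eq_zsmul]
        rw [hr, ← hcon l, Matrix.vecMul_sum, Matrix.vecMul_eq_sum]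
        simp only [Matrix.vecMul_smul, htM]
    -- Triangularity: the coefficient of `X ^ (e - m)` in `r` is `φ m` plus multiples of the `φ i`
    -- with `i < m`.
    have hind : ∀ m (hm : m < e + 1), φ ⟨m, hm⟩ = 0 := by
      intro m
      induction m using Nat.strong_induction_on with
      | _ m ih =>
        intro hm
        have := hrcoeff (e - m)
        rw [hr0, coeff_zero, Finset.sum_eq_single ⟨m, hm⟩, show e - m + (m + 1) = e + 1 by omega,
          hlead, mul_one] at this
        · exact this.symm
        · intro i _ hi
          have hi' : (i : ℕ) ≠ m := fun h => hi (Fin.ext h)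
          rcases lt_or_gt_of_ne hi' with hlt | hgt
          · rw [show φ i = 0 from ih i hlt i.2, zero_mul]
          · rw [hlarge _ (by omega), mul_zero]
        · simp
    exact funext fun i => hind i i.2
  · refine ⟨x, fun h0 => hx (dotProduct_self_eq_zero.1 ?_)⟩
    have := congrFun h0 (Fin.last e)
    rwa [Matrix.mulVec, htM, Fin.val_last, hMtop, Matrix.vecMul_one] at this
  -- Each coefficient `h.coeff (k + 1)` occurs once for every `i ≤ k`, which produces the factor `k
  -- + 1` of the derivative.
  · have hderiv : ∑ i : Fin (e + 1), X ^ (i : ℕ) * β (i + 1) = derivative h := by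
      ext k
      have hterm : ∀ i : ℕ, (X ^ i * β (i + 1)).coeff k = if i ≤ k then h.coeff (k + 1) else 0 := by
        intro i
        rw [coeff_X_pow_mul']
        split_ifs with hik
        · rw [hβ, show k - i + (i + 1) = k + 1 by omega]
        · rfl
      rw [finsetSum_coeff, coeff_derivative,
        Fin.sum_univ_eq_sum_range (fun i : ℕ => ((X : ℤ[X]) ^ i * β (i + 1)).coeff k)]
      simp only [hterm]
      rcases le_or_gt k e with hk | hk
      · rw [← Finset.sum_subset (Finset.range_subset_range.2 (Nat.succ_le_succ hk)) fun i _ hi =>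
          if_neg fun hik => hi (Finset.mem_range.2 (Nat.lt_succ_of_le hik)),
          Finset.sum_congr rfl fun i hi => if_pos (Nat.lt_succ_iff.1 (Finset.mem_range.1 hi))]
        simp [mul_comm]
      · simp [hlarge (k + 1) (by omega)]
    convert hunit using 1
    rw [← hderiv, map_sum]
    ext x y
    simp only [Matrix.sum_apply, Matrix.mul_apply, map_mul, map_pow, aeval_X]
    rw [Finset.sum_comm]
    refine Finset.sum_congr rfl fun i _ => Finset.sum_congr rfl fun a _ => ?_
    rw [hpA, htM]
    simp [M]


end Companion

theorem mainTheorem1 (n : ℕ) (hn : 1 ≤ n) (A : Matrix (Fin n) (Fin n) ℝ)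
    (hA : MatrixDiagonalizable (A.map (algebraMap ℝ ℂ))) :
    (∃ (m : ℕ) (Λ : CutAndProjectScheme n m), Λ.Generic ∧ Λ.IsSelfSimilarity A) ↔
      ∀ μ ∈ spectrum ℂ (A.map (algebraMap ℝ ℂ)), IsIntegral ℤ μ := by
  constructor
  · rintro ⟨m, Λ, -, hΛ⟩ μ hμ
    exact isIntegral_of_mem_spectrum_of_isSelfSimilarity hΛ hμ
  · intro hint
    obtain ⟨h, hmonic, h0, hunit, hmin⟩ := exists_separable_integral_annihilator hA hint
    obtain ⟨d, C, p, t, hd, hp, ht, hpz, htφ, htx, hu⟩ :=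
      exists_companion_intertwiners hn hmonic h0 hunit hmin
    exact exists_generic_scheme_of_intertwiner_families hn hd p t hp ht hpz htφ htx hu
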